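/- For a function $p:\mathbb R\to\mathbb R$ let $$\|p\|_{\rm TV}=\sup\sum_{k=1}^n|p(x_k)-p(x_{k-1})|,$$ the supremum being over all finite collections $x_0<x_1<\dots<x_n$ of real numbers. For a real random variable $X$ whose distribution has an absolutely continuous density $p$ with respect to Lebesgue measure (absolutely continuous on every compact interval), its Fisher information is $$I(X)=\int_{\{p>0\}}\frac{p'(x)^2}{p(x)}\,dx\in[0,\infty],$$ where $p'$ is the almost everywhere defined derivative of $p$; in all other cases $I(X)=+\infty$. Let $X_1,X_2,X_3$ be independent real random variables having densities $p_1,p_2,p_3$ (non-negative measurable functions) with $\|p_i\|_{\rm TV}<\infty$ for $i=1,2,3$. Then $S=X_1+X_2+X_3$ has finite Fisher information, and moreover $$I(S)\le\frac12\Big[\|p_1\|_{\rm TV}\|p_2\|_{\rm TV}+\|p_1\|_{\rm TV}\|p_3\|_{\rm TV}+\|p_2\|_{\rm TV}\|p_3\|_{\rm TV}\Big].$$ -/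

import Mathlib

open MeasureTheory ProbabilityTheory
open scoped ENNReal

/-- `p` is a (version of the) density of the measure `ν` on the line with respect to
Lebesgue measure. -/
structure IsDensity (ν : Measure ℝ) (p : ℝ → ℝ) : Prop where
  measurable : Measurable p
  nonneg : ∀ x, 0 ≤ p x
  eq_withDensity : ν = volume.withDensity fun x => ENNReal.ofReal (p x)

/-- `p` is absolutely continuous on every compact interval. -/
def IsAbsCont (p : ℝ → ℝ) : Prop :=
  ∀ a b : ℝ, AbsolutelyContinuousOnInterval p a b

/-- The integral of `p'(x)² / p(x)` over the set where `p` is positive. The derivative of an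
absolutely continuous function exists almost everywhere. -/
noncomputable def fisherIntegral (p : ℝ → ℝ) : ℝ≥0∞ :=
  ∫⁻ x in {x | 0 < p x}, ENNReal.ofReal (deriv p x ^ 2 / p x)

/-- Fisher information of a measure on the line: the Fisher integral of its absolutely continuous
density if there is one, and `∞` (the infimum of the empty set) otherwise. There is at most one
such density, see `fisherInfo_eq`. -/
noncomputable def fisherInfo (ν : Measure ℝ) : ℝ≥0∞ :=
  ⨅ (p : ℝ → ℝ) (_ : IsDensity ν p) (_ : IsAbsCont p), fisherIntegral p

/-- Total variation over the real line: the supremum of `∑ |p (x_k) - p (x_{k-1})|`. -/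
noncomputable def tvNorm (p : ℝ → ℝ) : ℝ≥0∞ :=
  eVariationOn p Set.univ

theorem IsAbsCont.continuous {p : ℝ → ℝ} (hp : IsAbsCont p) : Continuous p := by
  rw [continuous_iff_continuousAt]
  intro x
  refine (hp (x - 1) (x + 1)).continuousOn.continuousAt ?_
  rw [Set.uIcc_of_le (by linarith)]
  exact Icc_mem_nhds (by linarith) (by linarith)

theorem IsDensity.eq_of_isAbsCont {ν : Measure ℝ} [IsFiniteMeasure ν] {p q : ℝ → ℝ}
    (hp : IsDensity ν p) (hq : IsDensity ν q) (hpc : IsAbsCont p) (hqc : IsAbsCont q) :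
    p = q := by
  have h : (fun x => ENNReal.ofReal (p x)) =ᵐ[volume] fun x => ENNReal.ofReal (q x) := by
    refine (withDensity_eq_iff hp.measurable.ennreal_ofReal.aemeasurable
      hq.measurable.ennreal_ofReal.aemeasurable ?_).1 (hp.eq_withDensity ▸ hq.eq_withDensity)
    have h1 := measure_ne_top ν Set.univ
    rwa [hp.eq_withDensity, withDensity_apply _ MeasurableSet.univ,
      Measure.restrict_univ] at h1
  have h2 : p =ᵐ[volume] q := by
    filter_upwards [h] with x hx
    exact (ENNReal.ofReal_eq_ofReal_iff (hp.nonneg x) (hq.nonneg x)).1 hx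
  exact (Continuous.ae_eq_iff_eq volume hpc.continuous hqc.continuous).1 h2

theorem fisherInfo_eq {ν : Measure ℝ} [IsFiniteMeasure ν] {p : ℝ → ℝ}
    (hp : IsDensity ν p) (hpc : IsAbsCont p) : fisherInfo ν = fisherIntegral p := by
  refine le_antisymm (iInf_le_of_le p (iInf_le_of_le hp (iInf_le _ hpc))) ?_
  refine le_iInf fun q => le_iInf fun hq => le_iInf fun hqc => ?_
  rw [hp.eq_of_isAbsCont hq hpc hqc]

/-! The proof reduces the inequality to a statement about three intervals. A density of bounded
variation is an almost everywhere limit from below of non-negative combinations `∑ c i • 1_(b i, b i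
+ a i]`, with `∑ c i` at most half the total variation and integral `∑ c i * a i` at most 1.

For intervals of lengths `a`, `b`, `c`, the convolution `f` of the three indicators is non-negative,
satisfies `f'' ≤ 1` almost everywhere, and is supported on length `a + b + c`. Taylor's formula at
the point `x - f' x` gives `f' ^ 2 ≤ 2 * f`, so the Fisher integral is at most `2 * (a + b + c)`.
This is `boxConv₃Deriv_sq_le`.

The quotient `g ^ 2 / f` is jointly convex and homogeneous, so these bounds add up over mixtures
(`HasFisherControl.sum`): each term pairs one integral with two weights, and the constant is `2 *
(1/2) * (1/2) = 1/2`. The second-order Taylor bounds are uniform, so derivatives converge along the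
approximation, and Fatou's lemma carries the bound to the limit
(`isAbsCont_and_fisherIntegral_le_of_tendsto`). Writing `g ^ 2 ≤ f * K` avoids division at zeros of
`f`. -/

open Filter Topology

/-! ### Fisher control: additivity and stability under limits -/

/-- Data controlling the Fisher integral of `f`: a derivative `g` with a uniform quadratic Taylor
bound, and a function `K` with `g² ≤ f K` and total integral at most `κ`. -/
structure FisherControl (L κ : ℝ) (f g K : ℝ → ℝ) : Prop where
  nonneg : ∀ x, 0 ≤ f x
  taylor : ∀ x y, |f y - f x - (y - x) * g x| ≤ L * (y - x) ^ 2
  measurable : Measurable K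
  bound_nonneg : ∀ x, 0 ≤ K x
  sq_le : ∀ x, g x ^ 2 ≤ f x * K x
  lintegral_le : ∫⁻ x, ENNReal.ofReal (K x) ≤ ENNReal.ofReal κ

/-- The Fisher integral of `f` can be controlled by `κ`. -/
def HasFisherControl (L κ : ℝ) (f : ℝ → ℝ) : Prop :=
  ∃ g K : ℝ → ℝ, FisherControl L κ f g K

theorem HasFisherControl.mono {L κ L' κ' : ℝ} {f : ℝ → ℝ} (h : HasFisherControl L κ f)
    (hL : L ≤ L') (hκ : κ ≤ κ') : HasFisherControl L' κ' f := by
  obtain ⟨g, K, h⟩ := h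
  refine ⟨g, K, h.nonneg, fun x y => (h.taylor x y).trans ?_, h.measurable, h.bound_nonneg,
    h.sq_le, h.lintegral_le.trans (ENNReal.ofReal_le_ofReal hκ)⟩
  gcongr

theorem HasFisherControl.const_mul {L κ c : ℝ} {f : ℝ → ℝ} (h : HasFisherControl L κ f)
    (hc : 0 ≤ c) : HasFisherControl (c * L) (c * κ) (fun x => c * f x) := by
  obtain ⟨g, K, h⟩ := h
  refine ⟨fun x => c * g x, fun x => c * K x, fun x => mul_nonneg hc (h.nonneg x), fun x y => ?_,
    h.measurable.const_mul c, fun x => mul_nonneg hc (h.bound_nonneg x), fun x => ?_, ?_⟩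
  · have := mul_le_mul_of_nonneg_left (h.taylor x y) hc
    rw [← abs_of_nonneg hc, ← abs_mul, abs_of_nonneg hc] at this
    calc _ = |c * (f y - f x - (y - x) * g x)| := by ring_nf
      _ ≤ _ := this
      _ = _ := by ring
  · have := mul_le_mul_of_nonneg_left (h.sq_le x) (mul_nonneg hc hc)
    calc _ = c * c * g x ^ 2 := by ring
      _ ≤ _ := this
      _ = _ := by ring
  · simp_rw [ENNReal.ofReal_mul hc]
    rw [lintegral_const_mul _ h.measurable.ennreal_ofReal]
    gcongr
    exact h.lintegral_le

/-- Cauchy–Schwarz: `g i ^ 2 ≤ f i * K i` for all `i` implies `(∑ g i) ^ 2 ≤ (∑ f i) * (∑ K i)`.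
This is the joint convexity of `g ^ 2 / f` in homogeneous form. -/
theorem HasFisherControl.sum {ι : Type*} (s : Finset ι) {L κ : ι → ℝ} {f : ι → ℝ → ℝ}
    (hκ : ∀ i, 0 ≤ κ i) (h : ∀ i, HasFisherControl (L i) (κ i) (f i)) :
    HasFisherControl (∑ i ∈ s, L i) (∑ i ∈ s, κ i) (fun x => ∑ i ∈ s, f i x) := by
  choose g K h using h
  refine ⟨fun x => ∑ i ∈ s, g i x, fun x => ∑ i ∈ s, K i x,
    fun x => Finset.sum_nonneg fun i _ => (h i).nonneg x, fun x y => ?_,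
    Finset.measurable_sum _ fun i _ => (h i).measurable,
    fun x => Finset.sum_nonneg fun i _ => (h i).bound_nonneg x, fun x => ?_, ?_⟩
  · rw [← Finset.sum_sub_distrib, Finset.mul_sum, ← Finset.sum_sub_distrib, Finset.sum_mul]
    exact (Finset.abs_sum_le_sum_abs _ _).trans (Finset.sum_le_sum fun i _ => (h i).taylor x y)
  · exact Finset.sum_sq_le_sum_mul_sum_of_sq_le_mul s (fun i _ => (h i).nonneg x)
      (fun i _ => (h i).bound_nonneg x) fun i _ => (h i).sq_le x
  · calc ∫⁻ x, ENNReal.ofReal (∑ i ∈ s, K i x) = ∫⁻ x, ∑ i ∈ s, ENNReal.ofReal (K i x) := by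
          congr with x
          exact ENNReal.ofReal_sum_of_nonneg fun i _ => (h i).bound_nonneg x
      _ = ∑ i ∈ s, ∫⁻ x, ENNReal.ofReal (K i x) :=
          lintegral_finsetSum _ fun i _ => (h i).measurable.ennreal_ofReal
      _ ≤ ∑ i ∈ s, ENNReal.ofReal (κ i) := Finset.sum_le_sum fun i _ => (h i).lintegral_le
      _ = _ := (ENNReal.ofReal_sum_of_nonneg fun i _ => hκ i).symm

/-- A pointwise limit of functions with a uniform quadratic Taylor bound satisfies the same bound,
and the derivatives converge. -/
theorem exists_tendsto_of_taylor {L : ℝ} {F G : ℕ → ℝ → ℝ} {f : ℝ → ℝ}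
    (hT : ∀ n x y, |F n y - F n x - (y - x) * G n x| ≤ L * (y - x) ^ 2)
    (hlim : ∀ x, Tendsto (fun n => F n x) atTop (𝓝 (f x))) :
    ∃ g : ℝ → ℝ, (∀ x, Tendsto (fun n => G n x) atTop (𝓝 (g x))) ∧
      ∀ x y, |f y - f x - (y - x) * g x| ≤ L * (y - x) ^ 2 := by
  have hL : 0 ≤ L := by
    have := (abs_nonneg _).trans (hT 0 0 1)
    norm_num at this
    exact this
  have hC : ∀ x, CauchySeq fun n => G n x := by
    intro x
    rw [Metric.cauchySeq_iff']
    intro ε hε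
    -- `G n x` is compared with the difference quotient of fixed step `t`, which converges in `n`.
    -- The two Taylor errors and the Cauchy tolerance each cost at most `ε / 4`; the `+ 1` covers `L
    -- = 0`.
    set t : ℝ := ε / (4 * (L + 1)) with ht
    have ht0 : 0 < t := by positivity
    have hLt : L * t ≤ ε / 4 := by
      rw [ht, mul_div_assoc', div_le_iff₀ (by positivity)]
      nlinarith
    have hcau : CauchySeq fun n => F n (x + t) - F n x :=
      ((hlim (x + t)).sub (hlim x)).cauchySeq
    obtain ⟨N, hN⟩ := Metric.cauchySeq_iff'.1 hcau (t * (ε / 4)) (by positivity)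
    refine ⟨N, fun n hn => ?_⟩
    have h1 := hN n hn
    have h2 := hT n x (x + t)
    have h3 := hT N x (x + t)
    rw [Real.dist_eq] at h1 ⊢
    have h4 : t * |G n x - G N x| < t * ε := by
      rw [← abs_of_pos ht0, ← abs_mul, abs_of_pos ht0]
      have e : L * (x + t - x) ^ 2 ≤ t * (ε / 4) := by
        have : L * (x + t - x) ^ 2 = t * (L * t) := by ring
        rw [this]; gcongr
      have e2 : t * (G n x - G N x) = (F n (x + t) - F n x - (F N (x + t) - F N x))
        - (F n (x + t) - F n x - (x + t - x) * G n x)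
        + (F N (x + t) - F N x - (x + t - x) * G N x) := by ring
      rw [e2]
      have h5 := h2.trans e
      have h6 := h3.trans e
      have h7 : 0 < t * ε := by positivity
      rw [abs_lt] at *
      rw [abs_le] at h5 h6
      constructor <;> linarith
    exact lt_of_mul_lt_mul_left h4 ht0.le
  choose g hg using fun x => cauchySeq_tendsto_of_complete (hC x)
  refine ⟨g, hg, fun x y => ?_⟩
  exact le_of_tendsto (((hlim y).sub (hlim x)).sub ((hg x).const_mul (y - x))).abs
    (Eventually.of_forall fun n => hT n x y)

theorem hasDerivAt_of_taylor {L : ℝ} {f g : ℝ → ℝ}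
    (h : ∀ x y, |f y - f x - (y - x) * g x| ≤ L * (y - x) ^ 2) (x : ℝ) :
    HasDerivAt f (g x) x := by
  rw [hasDerivAt_iff_isLittleO]
  have h1 : (fun y => f y - f x - (y - x) • g x) =O[𝓝 x] fun y => (y - x) ^ 2 := by
    refine Asymptotics.IsBigO.of_bound L (Eventually.of_forall fun y => ?_)
    simpa using h x y
  refine h1.trans_isLittleO ?_
  have h2 : (fun t : ℝ => t ^ 2) =o[𝓝 0] fun t => t :=
    Asymptotics.isLittleO_pow_id (by norm_num)
  have h3 : Tendsto (fun y => y - x) (𝓝 x) (𝓝 0) := by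
    have : Tendsto (fun y => y - x) (𝓝 x) (𝓝 (x - x)) := tendsto_id.sub tendsto_const_nhds
    simpa using this
  exact h2.comp_tendsto h3

/-- Adding the Taylor bounds at `x` and at `y` shows that `g` is `2 * L`-Lipschitz, hence `f` is
continuously differentiable. -/
theorem isAbsCont_of_taylor {L : ℝ} {f g : ℝ → ℝ}
    (h : ∀ x y, |f y - f x - (y - x) * g x| ≤ L * (y - x) ^ 2) : IsAbsCont f := by
  intro a b
  have hg : ∀ x y, |g y - g x| ≤ 2 * L * |y - x| := by
    intro x y
    rcases eq_or_ne x y with rfl | hxy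
    · simp
    have hpos : 0 < |y - x| := abs_pos.2 (sub_ne_zero.2 hxy.symm)
    have h1 := h x y
    have h2 := h y x
    have h3 : |y - x| * |g y - g x| ≤ |y - x| * (2 * L * |y - x|) := by
      rw [← abs_mul]
      have e : (y - x) * (g y - g x) = (f y - f x - (y - x) * g x)
        + (f x - f y - (x - y) * g y) := by ring
      rw [e]
      refine (abs_add_le _ _).trans ((add_le_add h1 h2).trans (le_of_eq ?_))
      have := sq_abs (y - x)
      linear_combination (-2 * L) * this
    exact le_of_mul_le_mul_left h3 hpos
  have hcont : Continuous g := by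
    have hL : 0 ≤ L := by
      have := (abs_nonneg _).trans (h 0 1)
      norm_num at this
      exact this
    refine (LipschitzWith.of_dist_le_mul (K := (2 * L).toNNReal) fun y x => ?_).continuous
    rw [Real.dist_eq, Real.dist_eq, Real.coe_toNNReal _ (by positivity)]
    exact hg x y
  have hd : ContDiff ℝ 1 f := by
    refine contDiff_one_iff_deriv.2 ⟨fun x => (hasDerivAt_of_taylor h x).differentiableAt, ?_⟩
    have : deriv f = g := funext fun x => (hasDerivAt_of_taylor h x).deriv
    rwa [this]
  exact hd.contDiffOn.absolutelyContinuousOnInterval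

/-- The limit of functions with a common Fisher control is absolutely continuous and its Fisher
integral obeys the same bound. -/
theorem isAbsCont_and_fisherIntegral_le_of_tendsto {L κ : ℝ} {F : ℕ → ℝ → ℝ} {f : ℝ → ℝ}
    (hF : ∀ n, HasFisherControl L κ (F n))
    (hlim : ∀ x, Tendsto (fun n => F n x) atTop (𝓝 (f x))) :
    IsAbsCont f ∧ fisherIntegral f ≤ ENNReal.ofReal κ := by
  choose G K h using hF
  obtain ⟨g, hg, hT⟩ := exists_tendsto_of_taylor (fun n => (h n).taylor) hlim
  refine ⟨isAbsCont_of_taylor hT, ?_⟩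
  -- Where `f x > 0` the quotients `G n x ^ 2 / F n x` converge and are eventually at most `K n x`.
  -- The `K n` need not converge, hence the `liminf`, to which Fatou's lemma applies.
  have key : ∀ x, 0 < f x → ENNReal.ofReal (deriv f x ^ 2 / f x) ≤
      liminf (fun n => ENNReal.ofReal (K n x)) atTop := by
    intro x hx
    rw [(hasDerivAt_of_taylor hT x).deriv]
    have h1 : Tendsto (fun n => ENNReal.ofReal (G n x ^ 2 / F n x)) atTop
        (𝓝 (ENNReal.ofReal (g x ^ 2 / f x))) :=
      (ENNReal.continuous_ofReal.tendsto _).comp (((hg x).pow 2).div (hlim x) hx.ne')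
    rw [← h1.liminf_eq]
    refine liminf_le_liminf ?_
    filter_upwards [(hlim x).eventually (lt_mem_nhds hx)] with n hn
    refine ENNReal.ofReal_le_ofReal ?_
    rw [div_le_iff₀ hn, mul_comm]
    exact (h n).sq_le x
  calc fisherIntegral f
      ≤ ∫⁻ x in {x | 0 < f x}, liminf (fun n => ENNReal.ofReal (K n x)) atTop := by
        refine setLIntegral_mono' ?_ fun x hx => key x hx
        exact (isAbsCont_of_taylor hT).continuous.measurable measurableSet_Ioi
    _ ≤ ∫⁻ x, liminf (fun n => ENNReal.ofReal (K n x)) atTop := setLIntegral_le_lintegral _ _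
    _ ≤ liminf (fun n => ∫⁻ x, ENNReal.ofReal (K n x)) atTop :=
        lintegral_liminf_le fun n => (h n).measurable.ennreal_ofReal
    _ ≤ liminf (fun _ : ℕ => ENNReal.ofReal κ) atTop :=
        liminf_le_liminf (Eventually.of_forall fun n => (h n).lintegral_le)
    _ = _ := by simp

/-! ### The convolution of three interval indicators -/

/-- A one-sided Lipschitz bound on the derivative gives a one-sided quadratic Taylor bound. -/
theorem taylor_upper_of_deriv_sub_le {G g : ℝ → ℝ} {M : ℝ} (hG : ∀ x, HasDerivAt G (g x) x)
    (hg : ∀ x y, x ≤ y → g y - g x ≤ M * (y - x)) (x y : ℝ) :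
    G y - G x - (y - x) * g x ≤ M / 2 * (y - x) ^ 2 := by
  -- The derivative of `φ` is non-negative to the left of `x` and non-positive to the right, so `φ`
  -- is maximal at `x`.
  set φ : ℝ → ℝ := fun z => G z - (z - x) * g x - M / 2 * (z - x) ^ 2 with hφ
  have hd : ∀ z, HasDerivAt φ (g z - g x - M * (z - x)) z := by
    intro z
    have h1 : HasDerivAt (fun z : ℝ => z - x) 1 z := (hasDerivAt_id z).sub_const x
    refine (((hG z).sub (h1.mul_const (g x))).sub ((h1.pow 2).const_mul (M / 2))).congr_deriv ?_
    simp
    ring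
  have hc : Continuous φ := continuous_iff_continuousAt.2 fun z => (hd z).continuousAt
  suffices φ y ≤ φ x by
    simp only [hφ] at this
    linarith
  rcases lt_trichotomy x y with hxy | rfl | hxy
  · obtain ⟨z, hz, he⟩ := exists_hasDerivAt_eq_slope φ _ hxy hc.continuousOn fun z _ => hd z
    have h1 := hg x z hz.1.le
    rw [eq_div_iff (by linarith)] at he
    nlinarith
  · exact le_rfl
  · obtain ⟨z, hz, he⟩ := exists_hasDerivAt_eq_slope φ _ hxy hc.continuousOn fun z _ => hd z
    have h1 := hg z x hz.2.le
    rw [eq_div_iff (by linarith)] at he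
    nlinarith

/-- The half-parabola, a primitive of the positive part. -/
noncomputable def halfParabola (x : ℝ) : ℝ := max x 0 ^ 2 / 2

theorem hasDerivAt_halfParabola (x : ℝ) : HasDerivAt halfParabola (max x 0) x := by
  refine hasDerivAt_of_taylor (L := 1) (g := fun x => max x 0) (fun x y => ?_) x
  unfold halfParabola
  rw [abs_le]
  rcases le_total x 0 with hx | hx <;> rcases le_total y 0 with hy | hy <;>
    simp only [max_eq_left, max_eq_right, hx, hy] <;> constructor <;> nlinarith

/-- The convolution of the indicators of `(0, a]` and `(0, b]`. -/
noncomputable def boxConv₂ (a b x : ℝ) : ℝ :=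
  max x 0 - max (x - a) 0 - max (x - b) 0 + max (x - a - b) 0

/-- A primitive of `boxConv₂`. -/
noncomputable def boxConv₂Primitive (a b x : ℝ) : ℝ :=
  halfParabola x - halfParabola (x - a) - halfParabola (x - b) + halfParabola (x - a - b)

/-- The convolution of the indicators of `(0, a]`, `(0, b]` and `(0, c]`. -/
noncomputable def boxConv₃ (a b c x : ℝ) : ℝ :=
  boxConv₂Primitive b c x - boxConv₂Primitive b c (x - a)

/-- The derivative of `boxConv₃`. -/
noncomputable def boxConv₃Deriv (a b c x : ℝ) : ℝ :=
  boxConv₂ b c x - boxConv₂ b c (x - a)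

theorem continuous_boxConv₂ (a b : ℝ) : Continuous (boxConv₂ a b) := by
  unfold boxConv₂
  fun_prop

/-- The right side is the length of `(0, a] ∩ (x - b, x]`, the form in which the convolution
integral is computed. -/
theorem boxConv₂_eq {a b : ℝ} (ha : 0 ≤ a) (hb : 0 ≤ b) (x : ℝ) :
    boxConv₂ a b x = max 0 (min a x - max 0 (x - b)) := by
  unfold boxConv₂
  grind

theorem boxConv₂_nonneg {a b : ℝ} (ha : 0 ≤ a) (hb : 0 ≤ b) (x : ℝ) : 0 ≤ boxConv₂ a b x := by
  rw [boxConv₂_eq ha hb]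
  exact le_max_left _ _

theorem hasDerivAt_boxConv₂Primitive (a b x : ℝ) :
    HasDerivAt (boxConv₂Primitive a b) (boxConv₂ a b x) x := by
  have h := fun d : ℝ => (hasDerivAt_halfParabola (x - d)).comp_sub_const x d
  have h3 := h (a + b)
  simp only [← sub_sub] at h3
  exact (((hasDerivAt_halfParabola x).sub (h a)).sub (h b)).add h3

theorem hasDerivAt_boxConv₃ (a b c x : ℝ) :
    HasDerivAt (boxConv₃ a b c) (boxConv₃Deriv a b c x) x :=
  (hasDerivAt_boxConv₂Primitive b c x).sub
    ((hasDerivAt_boxConv₂Primitive b c (x - a)).comp_sub_const x a)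

theorem boxConv₃_nonneg {a b c : ℝ} (ha : 0 ≤ a) (hb : 0 ≤ b) (hc : 0 ≤ c) (x : ℝ) :
    0 ≤ boxConv₃ a b c x := by
  have hm : Monotone (boxConv₂Primitive b c) :=
    monotone_of_deriv_nonneg (fun x => (hasDerivAt_boxConv₂Primitive b c x).differentiableAt)
      fun x => by
        rw [(hasDerivAt_boxConv₂Primitive b c x).deriv]
        exact boxConv₂_nonneg hb hc x
  exact sub_nonneg.2 (hm (by linarith))

theorem boxConv₃_eq_zero_of_nonpos {a b c x : ℝ} (ha : 0 ≤ a) (hb : 0 ≤ b) (hc : 0 ≤ c)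
    (hx : x ≤ 0) : boxConv₃ a b c x = 0 := by
  have h : ∀ y ≤ (0 : ℝ), halfParabola y = 0 := fun y hy => by
    simp [halfParabola, max_eq_right hy]
  unfold boxConv₃ boxConv₂Primitive
  repeat rw [h _ (by linarith)]
  ring

/-- To the right of the support every half-parabola is a full parabola, and a third-order difference
of a quadratic vanishes. -/
theorem boxConv₃_eq_zero_of_le {a b c x : ℝ} (ha : 0 ≤ a) (hb : 0 ≤ b) (hc : 0 ≤ c)
    (hx : a + b + c ≤ x) : boxConv₃ a b c x = 0 := by
  have h : ∀ y : ℝ, 0 ≤ y → halfParabola y = y ^ 2 / 2 := fun y hy => by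
    simp [halfParabola, max_eq_left hy]
  unfold boxConv₃ boxConv₂Primitive
  repeat rw [h _ (by linarith)]
  ring

/-- The increment over `[x, y]` of the convolution of the indicator of `(u, u + c]` with the
half-line. -/
theorem max_sub_max_increment {c x y : ℝ} (hc : 0 ≤ c) (hxy : x ≤ y) (u : ℝ) :
    (max (y - u) 0 - max (y - u - c) 0) - (max (x - u) 0 - max (x - u - c) 0) =
      max 0 (min y (u + c) - max x u) := by
  grind

/-- Almost everywhere the second derivative is the signed sum of the indicators of `(u, u + c]` for
`u = 0, a, b, a + b`; this is its integral over `[x, y]`, with no second derivative needed. -/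
theorem boxConv₃Deriv_sub_eq {c x y : ℝ} (hc : 0 ≤ c) (hxy : x ≤ y) (a b : ℝ) :
    boxConv₃Deriv a b c y - boxConv₃Deriv a b c x =
      max 0 (min y (0 + c) - max x 0) - max 0 (min y (a + c) - max x a)
      - max 0 (min y (b + c) - max x b) + max 0 (min y (a + b + c) - max x (a + b)) := by
  rw [← max_sub_max_increment hc hxy 0, ← max_sub_max_increment hc hxy a,
    ← max_sub_max_increment hc hxy b, ← max_sub_max_increment hc hxy (a + b)]
  unfold boxConv₃Deriv boxConv₂
  simp only [sub_zero, ← sub_sub]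
  ring

/-- If at most one of the two positive overlaps is non-zero, it is at most `y - x`. If both are
present, `q1` and `q2` show that the two subtracted overlaps compensate for them. -/
theorem boxConv₃Deriv_sub_le {a b c x y : ℝ} (ha : 0 ≤ a) (hb : 0 ≤ b) (hc : 0 ≤ c)
    (hxy : x ≤ y) : boxConv₃Deriv a b c y - boxConv₃Deriv a b c x ≤ 1 * (y - x) := by
  rw [boxConv₃Deriv_sub_eq hc hxy]
  have q1 : min y (0 + c) + min y (a + b + c) ≤ min y (a + c) + min y (b + c) := by grind
  have q2 : max x a + max x b ≤ max x 0 + max x (a + b) := by grind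
  have l1 : min y (0 + c) - max x 0 ≤ y - x :=
    sub_le_sub (min_le_left _ _) (le_max_left _ _)
  have l2 : min y (a + b + c) - max x (a + b) ≤ y - x :=
    sub_le_sub (min_le_left _ _) (le_max_left _ _)
  have r1 := le_max_left 0 (min y (a + c) - max x a)
  have r2 := le_max_left 0 (min y (b + c) - max x b)
  have r3 := le_max_right 0 (min y (a + c) - max x a)
  have r4 := le_max_right 0 (min y (b + c) - max x b)
  rcases le_total (min y (0 + c) - max x 0) 0 with h1 | h1 <;>
    rcases le_total (min y (a + b + c) - max x (a + b)) 0 with h2 | h2 <;>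
    simp only [max_eq_left, max_eq_right, h1, h2] <;> linarith

/-- The 2 counts the subtracted overlaps. It affects only the Taylor constant `L`, never the Fisher
bound. -/
theorem le_boxConv₃Deriv_sub {c x y : ℝ} (hc : 0 ≤ c) (hxy : x ≤ y) (a b : ℝ) :
    -(2 * (y - x)) ≤ boxConv₃Deriv a b c y - boxConv₃Deriv a b c x := by
  rw [boxConv₃Deriv_sub_eq hc hxy]
  have l : ∀ u, max 0 (min y (u + c) - max x u) ≤ y - x := fun u =>
    max_le (by linarith) (sub_le_sub (min_le_left _ _) (le_max_left _ _))
  have n : ∀ u, 0 ≤ max 0 (min y (u + c) - max x u) := fun u => le_max_left _ _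
  linarith [l a, l b, n 0, n (a + b)]

theorem boxConv₃_taylor {a b c : ℝ} (ha : 0 ≤ a) (hb : 0 ≤ b) (hc : 0 ≤ c) (x y : ℝ) :
    |boxConv₃ a b c y - boxConv₃ a b c x - (y - x) * boxConv₃Deriv a b c x| ≤
      1 * (y - x) ^ 2 := by
  have h1 := taylor_upper_of_deriv_sub_le (hasDerivAt_boxConv₃ a b c)
    (fun x y => boxConv₃Deriv_sub_le ha hb hc) x y
  have h2 := taylor_upper_of_deriv_sub_le (M := 2)
    (fun x => (hasDerivAt_boxConv₃ a b c x).neg)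
    (fun x y h => by linarith [le_boxConv₃Deriv_sub hc h a b]) x y
  simp only [Pi.neg_apply] at h2
  rw [abs_le]
  constructor <;> nlinarith [sq_nonneg (y - x)]

/-- With `f` the convolution and `d` its derivative at `x`, non-negativity and the upper Taylor
bound with `M = 1` give `0 ≤ f (x - d) ≤ f x - d ^ 2 + d ^ 2 / 2`. -/
theorem boxConv₃Deriv_sq_le {a b c : ℝ} (ha : 0 ≤ a) (hb : 0 ≤ b) (hc : 0 ≤ c) (x : ℝ) :
    boxConv₃Deriv a b c x ^ 2 ≤ 2 * boxConv₃ a b c x := by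
  have h1 := taylor_upper_of_deriv_sub_le (hasDerivAt_boxConv₃ a b c)
    (fun x y => boxConv₃Deriv_sub_le ha hb hc) x (x - boxConv₃Deriv a b c x)
  have h2 := boxConv₃_nonneg ha hb hc (x - boxConv₃Deriv a b c x)
  nlinarith

/-- The bound `K` is 2 on the support, an interval of length `a + b + c`. Off it the function
vanishes, and the quadratic inequality forces its derivative to vanish too. -/
theorem hasFisherControl_boxConv₃ {a b c : ℝ} (ha : 0 ≤ a) (hb : 0 ≤ b) (hc : 0 ≤ c) (d : ℝ) :
    HasFisherControl 1 (2 * (a + b + c)) (fun x => boxConv₃ a b c (x - d)) := by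
  refine ⟨fun x => boxConv₃Deriv a b c (x - d), (Set.Ioc d (d + (a + b + c))).indicator fun _ => 2,
    fun x => boxConv₃_nonneg ha hb hc _, fun x y => ?_,
    measurable_const.indicator measurableSet_Ioc,
    fun x => Set.indicator_nonneg (fun _ _ => by norm_num) x, fun x => ?_, ?_⟩
  · have := boxConv₃_taylor ha hb hc (x - d) (y - d)
    rwa [sub_sub_sub_cancel_right] at this
  · have h := boxConv₃Deriv_sq_le ha hb hc (x - d)
    by_cases hx : x ∈ Set.Ioc d (d + (a + b + c))
    · rw [Set.indicator_of_mem hx]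
      linarith
    · rw [Set.indicator_of_notMem hx]
      have h0 : boxConv₃ a b c (x - d) = 0 := by
        rcases le_or_gt x d with h | h
        · exact boxConv₃_eq_zero_of_nonpos ha hb hc (by linarith)
        · refine boxConv₃_eq_zero_of_le ha hb hc ?_
          by_contra h'
          exact hx ⟨h, by linarith⟩
      rw [h0] at h ⊢
      linarith
  · have : ∀ x, ENNReal.ofReal ((Set.Ioc d (d + (a + b + c))).indicator (fun _ => (2 : ℝ)) x) =
        (Set.Ioc d (d + (a + b + c))).indicator (fun _ => ENNReal.ofReal 2) x := fun x => by
      by_cases hx : x ∈ Set.Ioc d (d + (a + b + c)) <;> simp [hx]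
    simp_rw [this]
    rw [lintegral_indicator measurableSet_Ioc, setLIntegral_const, Real.volume_Ioc,
      add_sub_cancel_left, ← ENNReal.ofReal_mul (by norm_num)]

/-! ### The explicit formulas as convolutions -/

/-- The indicator of `(b, b + a]`. -/
noncomputable def box (b a : ℝ) : ℝ → ℝ≥0∞ := (Set.Ioc b (b + a)).indicator 1

theorem measurable_box (b a : ℝ) : Measurable (box b a) :=
  measurable_one.indicator measurableSet_Ioc

theorem box_lconvolution (b a : ℝ) (φ : ℝ → ℝ≥0∞) (x : ℝ) :
    (box b a ⋆ₗ φ) x = ∫⁻ y in Set.Ioc b (b + a), φ (x - y) := by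
  rw [lconvolution_def, ← lintegral_indicator measurableSet_Ioc]
  congr with y
  by_cases hy : y ∈ Set.Ioc b (b + a) <;> simp [box, hy, sub_eq_neg_add]

theorem box_lconvolution_box {a a' : ℝ} (ha : 0 ≤ a) (ha' : 0 ≤ a') (b b' x : ℝ) :
    (box b a ⋆ₗ box b' a') x = ENNReal.ofReal (boxConv₂ a a' (x - (b + b'))) := by
  rw [box_lconvolution]
  have h : ∀ y, box b' a' (x - y) = (Set.Ico (x - (b' + a')) (x - b')).indicator 1 y := by
    intro y
    have : x - y ∈ Set.Ioc b' (b' + a') ↔ y ∈ Set.Ico (x - (b' + a')) (x - b') := by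
      simp only [Set.mem_Ioc, Set.mem_Ico]
      constructor <;> intro h <;> constructor <;> linarith [h.1, h.2]
    by_cases hy : x - y ∈ Set.Ioc b' (b' + a')
    · rw [box, Set.indicator_of_mem hy, Set.indicator_of_mem (this.1 hy)]; rfl
    · rw [box, Set.indicator_of_notMem hy, Set.indicator_of_notMem (mt this.2 hy)]
  have hI : Set.Ico (x - (b' + a')) (x - b') =ᵐ[volume] Set.Ioc (x - (b' + a')) (x - b') :=
    Ico_ae_eq_Ioc
  simp_rw [h]
  rw [lintegral_indicator_one measurableSet_Ico, Measure.restrict_apply measurableSet_Ico,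
    measure_congr (hI.inter (ae_eq_refl (Set.Ioc b (b + a)))), Set.Ioc_inter_Ioc,
    Real.volume_Ioc, boxConv₂_eq ha ha', ENNReal.ofReal_max, ENNReal.ofReal_zero,
    max_eq_right zero_le]
  congr 1
  grind

theorem box_lconvolution_primitive {a : ℝ} (ha : 0 ≤ a) (b : ℝ) {φ Φ : ℝ → ℝ} (hφ : ∀ x, 0 ≤ φ x)
    (hc : Continuous φ) (hΦ : ∀ x, HasDerivAt Φ (φ x) x) (x : ℝ) :
    (box b a ⋆ₗ fun x => ENNReal.ofReal (φ x)) x = ENNReal.ofReal (Φ (x - b) - Φ (x - b - a)) := by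
  have hcc : Continuous fun y => φ (x - y) := hc.comp (continuous_const.sub continuous_id)
  rw [box_lconvolution, ← ofReal_integral_eq_lintegral_ofReal
    (hcc.integrableOn_Ioc) (Eventually.of_forall fun y => hφ _),
    ← intervalIntegral.integral_of_le (by linarith),
    intervalIntegral.integral_comp_sub_left (fun y => φ y),
    intervalIntegral.integral_eq_sub_of_hasDerivAt (fun y _ => hΦ y)
      (hc.intervalIntegrable _ _), sub_add_eq_sub_sub]

theorem box_lconvolution_box_lconvolution_box {a₁ a₂ a₃ : ℝ} (h₁ : 0 ≤ a₁) (h₂ : 0 ≤ a₂)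
    (h₃ : 0 ≤ a₃) (b₁ b₂ b₃ x : ℝ) :
    (box b₁ a₁ ⋆ₗ (box b₂ a₂ ⋆ₗ box b₃ a₃)) x =
      ENNReal.ofReal (boxConv₃ a₁ a₂ a₃ (x - (b₁ + b₂ + b₃))) := by
  have h : (box b₂ a₂ ⋆ₗ box b₃ a₃) =
      fun x => ENNReal.ofReal (boxConv₂ a₂ a₃ (x - (b₂ + b₃))) :=
    funext fun x => box_lconvolution_box h₂ h₃ b₂ b₃ x
  rw [h, box_lconvolution_primitive h₁ b₁ (φ := fun x => boxConv₂ a₂ a₃ (x - (b₂ + b₃)))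
    (Φ := fun x => boxConv₂Primitive a₂ a₃ (x - (b₂ + b₃)))
    (fun x => boxConv₂_nonneg h₂ h₃ _)
    ((continuous_boxConv₂ a₂ a₃).comp (continuous_id.sub continuous_const))
    (fun x => (hasDerivAt_boxConv₂Primitive a₂ a₃ (x - (b₂ + b₃))).comp_sub_const x _)]
  unfold boxConv₃
  congr 3 <;> ring

/-! ### Mixtures of intervals -/

theorem lconvolution_sum_right {ι : Type*} (s : Finset ι) {φ : ℝ → ℝ≥0∞} {c : ι → ℝ≥0∞}
    {ψ : ι → ℝ → ℝ≥0∞} (hφ : Measurable φ) (hψ : ∀ i, Measurable (ψ i)) (x : ℝ) :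
    (φ ⋆ₗ fun x => ∑ i ∈ s, c i * ψ i x) x = ∑ i ∈ s, c i * (φ ⋆ₗ ψ i) x := by
  simp only [lconvolution_def, Finset.mul_sum]
  rw [lintegral_finsetSum _ fun i _ => by fun_prop]
  refine Finset.sum_congr rfl fun i _ => ?_
  rw [← lintegral_const_mul _ (by fun_prop)]
  congr with y
  ring

theorem lconvolution_sum_left {ι : Type*} (s : Finset ι) {φ : ℝ → ℝ≥0∞} {c : ι → ℝ≥0∞}
    {ψ : ι → ℝ → ℝ≥0∞} (hφ : Measurable φ) (hψ : ∀ i, Measurable (ψ i)) (x : ℝ) :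
    ((fun x => ∑ i ∈ s, c i * ψ i x) ⋆ₗ φ) x = ∑ i ∈ s, c i * (ψ i ⋆ₗ φ) x := by
  rw [lconvolution_comm, lconvolution_sum_right s hφ hψ]
  exact Finset.sum_congr rfl fun i _ => by rw [lconvolution_comm]

/-- A finite non-negative combination of indicators of the intervals `(b i, b i + a i]`. -/
structure IntervalMixture where
  ι : Type
  [fintype : Fintype ι]
  c : ι → ℝ
  b : ι → ℝ
  a : ι → ℝ
  c_nonneg : ∀ i, 0 ≤ c i
  a_nonneg : ∀ i, 0 ≤ a i

namespace IntervalMixture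

attribute [instance] IntervalMixture.fintype

/-- The function represented by the mixture. -/
noncomputable def fn (m : IntervalMixture) (x : ℝ) : ℝ≥0∞ :=
  ∑ i, ENNReal.ofReal (m.c i) * box (m.b i) (m.a i) x

/-- The sum of the coefficients. -/
noncomputable def weight (m : IntervalMixture) : ℝ := ∑ i, m.c i

/-- The integral of the mixture. -/
noncomputable def mass (m : IntervalMixture) : ℝ := ∑ i, m.c i * m.a i

theorem weight_nonneg (m : IntervalMixture) : 0 ≤ m.weight :=
  Finset.sum_nonneg fun i _ => m.c_nonneg i

theorem mass_nonneg (m : IntervalMixture) : 0 ≤ m.mass :=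
  Finset.sum_nonneg fun i _ => mul_nonneg (m.c_nonneg i) (m.a_nonneg i)

theorem measurable_fn (m : IntervalMixture) : Measurable m.fn :=
  Finset.measurable_sum _ fun _ _ => (measurable_box _ _).const_mul _

theorem lintegral_fn (m : IntervalMixture) : ∫⁻ x, m.fn x = ENNReal.ofReal m.mass := by
  unfold fn mass
  rw [lintegral_finsetSum _ fun _ _ => (measurable_box _ _).const_mul _,
    ENNReal.ofReal_sum_of_nonneg fun i _ => mul_nonneg (m.c_nonneg i) (m.a_nonneg i)]
  refine Finset.sum_congr rfl fun i _ => ?_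
  rw [lintegral_const_mul _ (measurable_box _ _), box, lintegral_indicator_one measurableSet_Ioc,
    Real.volume_Ioc, add_sub_cancel_left, ENNReal.ofReal_mul (m.c_nonneg i)]

/-- The triple convolution of interval mixtures, as a real function. -/
noncomputable def conv₃ (m₁ m₂ m₃ : IntervalMixture) (x : ℝ) : ℝ :=
  ∑ i, m₁.c i * ∑ j, m₂.c j * ∑ k, m₃.c k *
    boxConv₃ (m₁.a i) (m₂.a j) (m₃.a k) (x - (m₁.b i + m₂.b j + m₃.b k))

theorem lconvolution_eq (m₁ m₂ m₃ : IntervalMixture) (x : ℝ) :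
    (m₁.fn ⋆ₗ (m₂.fn ⋆ₗ m₃.fn)) x = ENNReal.ofReal (conv₃ m₁ m₂ m₃ x) := by
  have hbox := fun i j k => boxConv₃_nonneg (m₁.a_nonneg i) (m₂.a_nonneg j) (m₃.a_nonneg k)
  have h3 : ∀ i j k x, 0 ≤ m₃.c k *
      boxConv₃ (m₁.a i) (m₂.a j) (m₃.a k) (x - (m₁.b i + m₂.b j + m₃.b k)) :=
    fun i j k x => mul_nonneg (m₃.c_nonneg k) (hbox i j k _)
  have h2 : ∀ i j x, 0 ≤ m₂.c j * ∑ k, m₃.c k *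
      boxConv₃ (m₁.a i) (m₂.a j) (m₃.a k) (x - (m₁.b i + m₂.b j + m₃.b k)) :=
    fun i j x => mul_nonneg (m₂.c_nonneg j) (Finset.sum_nonneg fun k _ => h3 i j k x)
  have h1 : ∀ i x, 0 ≤ m₁.c i * ∑ j, m₂.c j * ∑ k, m₃.c k *
      boxConv₃ (m₁.a i) (m₂.a j) (m₃.a k) (x - (m₁.b i + m₂.b j + m₃.b k)) :=
    fun i x => mul_nonneg (m₁.c_nonneg i) (Finset.sum_nonneg fun j _ => h2 i j x)
  have e1 : (m₁.fn ⋆ₗ (m₂.fn ⋆ₗ m₃.fn)) x =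
      ∑ i, ENNReal.ofReal (m₁.c i) * (box (m₁.b i) (m₁.a i) ⋆ₗ (m₂.fn ⋆ₗ m₃.fn)) x :=
    lconvolution_sum_left _ (measurable_lconvolution _ m₂.measurable_fn m₃.measurable_fn)
      (fun _ => measurable_box _ _) x
  have e2 : (m₂.fn ⋆ₗ m₃.fn) =
      fun x => ∑ j, ENNReal.ofReal (m₂.c j) * (box (m₂.b j) (m₂.a j) ⋆ₗ m₃.fn) x :=
    funext fun x => lconvolution_sum_left _ m₃.measurable_fn (fun _ => measurable_box _ _) x
  have e3 : ∀ j, (box (m₂.b j) (m₂.a j) ⋆ₗ m₃.fn) = fun x => ∑ k, ENNReal.ofReal (m₃.c k) *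
      (box (m₂.b j) (m₂.a j) ⋆ₗ box (m₃.b k) (m₃.a k)) x :=
    fun j => funext fun x =>
      lconvolution_sum_right _ (measurable_box _ _) (fun _ => measurable_box _ _) x
  rw [e1, conv₃, ENNReal.ofReal_sum_of_nonneg fun i _ => h1 i x]
  refine Finset.sum_congr rfl fun i _ => ?_
  rw [ENNReal.ofReal_mul (m₁.c_nonneg i), ENNReal.ofReal_sum_of_nonneg fun j _ => h2 i j x, e2,
    lconvolution_sum_right _ (measurable_box _ _)
      fun j => measurable_lconvolution _ (measurable_box _ _) m₃.measurable_fn]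
  congr 1
  refine Finset.sum_congr rfl fun j _ => ?_
  rw [ENNReal.ofReal_mul (m₂.c_nonneg j), ENNReal.ofReal_sum_of_nonneg fun k _ => h3 i j k x, e3,
    lconvolution_sum_right _ (measurable_box _ _)
      fun k => measurable_lconvolution _ (measurable_box _ _) (measurable_box _ _)]
  congr 1
  refine Finset.sum_congr rfl fun k _ => ?_
  rw [ENNReal.ofReal_mul (m₃.c_nonneg k), box_lconvolution_box_lconvolution_box
    (m₁.a_nonneg i) (m₂.a_nonneg j) (m₃.a_nonneg k)]

/-- Each triple of intervals contributes twice the sum of its lengths times the product of its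
coefficients. Summation turns each length into a mass and leaves two weights. -/
theorem hasFisherControl_conv₃ (m₁ m₂ m₃ : IntervalMixture) :
    HasFisherControl (m₁.weight * (m₂.weight * m₃.weight))
      (2 * (m₁.mass * m₂.weight * m₃.weight + m₁.weight * m₂.mass * m₃.weight
        + m₁.weight * m₂.weight * m₃.mass)) (conv₃ m₁ m₂ m₃) := by
  have n3 : ∀ i j k, 0 ≤ m₃.c k * (2 * (m₁.a i + m₂.a j + m₃.a k)) := fun i j k =>
    mul_nonneg (m₃.c_nonneg k)
      (by linarith [m₁.a_nonneg i, m₂.a_nonneg j, m₃.a_nonneg k])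
  have n2 : ∀ i j, 0 ≤ m₂.c j * ∑ k, m₃.c k * (2 * (m₁.a i + m₂.a j + m₃.a k)) := fun i j =>
    mul_nonneg (m₂.c_nonneg j) (Finset.sum_nonneg fun k _ => n3 i j k)
  have n1 : ∀ i, 0 ≤ m₁.c i * ∑ j, m₂.c j * ∑ k, m₃.c k *
      (2 * (m₁.a i + m₂.a j + m₃.a k)) := fun i =>
    mul_nonneg (m₁.c_nonneg i) (Finset.sum_nonneg fun j _ => n2 i j)
  have h := HasFisherControl.sum Finset.univ n1 fun i =>
    (HasFisherControl.sum Finset.univ (n2 i) fun j =>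
      (HasFisherControl.sum Finset.univ (n3 i j) fun k =>
        (hasFisherControl_boxConv₃ (m₁.a_nonneg i) (m₂.a_nonneg j) (m₃.a_nonneg k)
          (m₁.b i + m₂.b j + m₃.b k)).const_mul (m₃.c_nonneg k)).const_mul
            (m₂.c_nonneg j)).const_mul (m₁.c_nonneg i)
  refine h.mono (le_of_eq ?_) (le_of_eq ?_)
  · simp only [weight, mul_one, Finset.sum_mul]
  · have s3 : ∀ A, ∑ k, m₃.c k * (2 * (A + m₃.a k)) = 2 * (A * m₃.weight + m₃.mass) := by
      intro A
      simp only [weight, mass, Finset.mul_sum, ← Finset.sum_add_distrib]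
      exact Finset.sum_congr rfl fun k _ => by ring
    have s2 : ∀ A, ∑ j, m₂.c j * (2 * ((A + m₂.a j) * m₃.weight + m₃.mass)) =
        2 * (A * m₂.weight * m₃.weight + m₂.mass * m₃.weight + m₂.weight * m₃.mass) := by
      intro A
      rw [show m₂.mass = ∑ j, m₂.c j * m₂.a j from rfl, show m₂.weight = ∑ j, m₂.c j from rfl]
      simp only [Finset.mul_sum, Finset.sum_mul, ← Finset.sum_add_distrib]
      exact Finset.sum_congr rfl fun j _ => by ring
    simp only [s3, s2]
    rw [show m₁.mass = ∑ i, m₁.c i * m₁.a i from rfl, show m₁.weight = ∑ i, m₁.c i from rfl]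
    simp only [Finset.mul_sum, Finset.sum_mul, ← Finset.sum_add_distrib]
    exact Finset.sum_congr rfl fun k _ => by ring

end IntervalMixture

/-! ### Approximation from below of a density of bounded variation -/

/-- A finite non-negative sequence starting at zero is a combination of indicators of integer
intervals `[i, k)`, with total weight the sum of its positive increments. -/
theorem exists_interval_decomposition (v : ℕ → ℝ) (hv : ∀ k, 0 ≤ v k) (hv0 : v 0 = 0) (n : ℕ) :
    ∃ (ι : Type) (_ : Fintype ι) (c : ι → ℝ) (l r : ι → ℕ), (∀ i, 0 ≤ c i) ∧ (∀ i, l i < r i) ∧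
      (∀ i, r i ≤ n + 1) ∧
      (∀ m ≤ n, ∑ i, (if l i ≤ m ∧ m < r i then c i else 0) = v m) ∧
      ∑ i, c i = ∑ k ∈ Finset.range n, max (v (k + 1) - v k) 0 := by
  induction n with
  | zero =>
    refine ⟨Empty, inferInstance, fun _ => 0, fun _ => 0, fun _ => 0, by simp, by simp, by simp,
      ?_, by simp⟩
    intro m hm
    obtain rfl : m = 0 := by omega
    simp [hv0]
  | succ n ih =>
    obtain ⟨ι, _, c, l, r, hc, hlr, hr, hsum, hw⟩ := ih
    obtain ⟨θ, hθ0, hθ1, s, hs0, hs, hθs⟩ : ∃ θ : ℝ, 0 ≤ θ ∧ θ ≤ 1 ∧ ∃ s : ℝ, 0 ≤ s ∧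
        s = max (v (n + 1) - v n) 0 ∧ θ * v n + s = v (n + 1) := by
      rcases le_or_gt (v n) (v (n + 1)) with h | h
      · refine ⟨1, zero_le_one, le_rfl, v (n + 1) - v n, by linarith, ?_, by ring⟩
        rw [max_eq_left (by linarith)]
      · have hpos : 0 < v n := (hv _).trans_lt h
        refine ⟨v (n + 1) / v n, div_nonneg (hv _) (hv _), (div_le_one hpos).2 h.le, 0, le_rfl, ?_,
          ?_⟩
        · rw [max_eq_right (by linarith)]
        · field_simp
          ring
    -- Each interval is split into fractions `θ` and `1 - θ`. The first is prolonged by one step if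
    -- it was still active at `n`, the second is not, and a new interval of weight `s` starts at `n
    -- + 1`. Only `s` adds to the total weight.
    refine ⟨ι ⊕ ι ⊕ Unit, inferInstance,
      Sum.elim (fun i => θ * c i) (Sum.elim (fun i => (1 - θ) * c i) fun _ => s),
      Sum.elim l (Sum.elim l fun _ => n + 1),
      Sum.elim (fun i => if r i = n + 1 then n + 2 else r i) (Sum.elim r fun _ => n + 2),
      ?_, ?_, ?_, ?_, ?_⟩
    · rintro (i | i | i)
      · exact mul_nonneg hθ0 (hc i)
      · exact mul_nonneg (by linarith) (hc i)
      · exact hs0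
    · rintro (i | i | i)
      · have := hlr i
        simp only [Sum.elim_inl]
        split_ifs <;> omega
      · exact hlr i
      · simp
    · rintro (i | i | i)
      · have := hr i
        simp only [Sum.elim_inl]
        split_ifs <;> omega
      · have := hr i
        simp only [Sum.elim_inl, Sum.elim_inr]
        omega
      · simp
    · intro m hm
      rw [Fintype.sum_sum_type, Fintype.sum_sum_type]
      change ∑ i, (if l i ≤ m ∧ m < (if r i = n + 1 then n + 2 else r i) then θ * c i else 0) +
        (∑ i, (if l i ≤ m ∧ m < r i then (1 - θ) * c i else 0) +
          ∑ _u : Unit, (if n + 1 ≤ m ∧ m < n + 2 then s else 0)) = v m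
      have hunit : ∀ z : ℝ, ∑ _u : Unit, z = z := by simp
      rw [hunit]
      rcases hm.lt_or_eq with h | rfl
      · have e1 : ∀ i, (if l i ≤ m ∧ m < (if r i = n + 1 then n + 2 else r i) then θ * c i else 0)
            = θ * (if l i ≤ m ∧ m < r i then c i else 0) := by
          intro i
          have : (m < if r i = n + 1 then n + 2 else r i) ↔ m < r i := by
            split_ifs <;> omega
          simp [this]
        have e2 : ∀ i, (if l i ≤ m ∧ m < r i then (1 - θ) * c i else 0)
            = (1 - θ) * (if l i ≤ m ∧ m < r i then c i else 0) := by
          intro i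
          simp
        simp only [e1, e2, ← Finset.mul_sum, hsum m (by omega)]
        rw [if_neg (by omega)]
        ring
      · have e1 : ∀ i, (if l i ≤ n + 1 ∧ n + 1 < (if r i = n + 1 then n + 2 else r i)
            then θ * c i else 0) = θ * (if l i ≤ n ∧ n < r i then c i else 0) := by
          intro i
          have h1 := hlr i
          have h2 := hr i
          have : (l i ≤ n + 1 ∧ n + 1 < if r i = n + 1 then n + 2 else r i) ↔
              l i ≤ n ∧ n < r i := by
            split_ifs <;> omega
          simp [this]
        have e2 : ∀ i, (if l i ≤ n + 1 ∧ n + 1 < r i then (1 - θ) * c i else 0) = 0 := by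
          intro i
          have h2 := hr i
          rw [if_neg (by omega)]
        simp only [e1, e2, ← Finset.mul_sum, hsum n le_rfl]
        simp [hθs]
    · simp only [Fintype.sum_sum_type, Sum.elim_inl, Sum.elim_inr, Finset.univ_unique,
        Finset.sum_singleton, ← Finset.mul_sum]
      rw [Finset.sum_range_succ, hw, hs]
      ring

/-- If both ends of a sequence vanish, its positive increments sum to half its variation. -/
theorem two_mul_sum_max_sub {v : ℕ → ℝ} {n : ℕ} (h0 : v 0 = 0) (hn : v n = 0) :
    2 * ∑ k ∈ Finset.range n, max (v (k + 1) - v k) 0 =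
      ∑ k ∈ Finset.range n, |v (k + 1) - v k| := by
  have h := Finset.sum_range_sub v n
  have e : ∀ k, |v (k + 1) - v k| = 2 * max (v (k + 1) - v k) 0 - (v (k + 1) - v k) := by
    intro k
    rcases le_total (v (k + 1) - v k) 0 with h | h
    · rw [abs_of_nonpos h, max_eq_right h]; ring
    · rw [abs_of_nonneg h, max_eq_left h]; ring
  simp only [e, Finset.sum_sub_distrib, ← Finset.mul_sum] at *
  rw [h, h0, hn]
  ring

/-- A sequence uniformly approximated by values of `p` at increasing points has variation at most
that of `p`. -/
theorem sum_abs_sub_le_tvNorm {p : ℝ → ℝ} (hp : tvNorm p < ∞) {v : ℕ → ℝ} {n : ℕ}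
    (h : ∀ ε > 0, ∃ u : ℕ → ℝ, MonotoneOn u (Set.Iic n) ∧ ∀ k ≤ n, |p (u k) - v k| ≤ ε) :
    ∑ k ∈ Finset.range n, |v (k + 1) - v k| ≤ (tvNorm p).toReal := by
  refine le_of_forall_pos_le_add fun δ hδ => ?_
  -- Each of the `n` increments is off by at most twice this tolerance, so the total error is at
  -- most `δ`.
  obtain ⟨u, hu, hpu⟩ := h (δ / (2 * (n + 1))) (by positivity)
  have h1 : ∑ k ∈ Finset.range n, |p (u (k + 1)) - p (u k)| ≤ (tvNorm p).toReal := by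
    have h2 : ∑ k ∈ Finset.range n, edist (p (u (k + 1))) (p (u k)) ≤ tvNorm p :=
      eVariationOn.sum_le_of_monotoneOn_Iic hu fun _ _ => Set.mem_univ _
    refine (ENNReal.ofReal_le_iff_le_toReal hp.ne).1 ?_
    rw [ENNReal.ofReal_sum_of_nonneg fun _ _ => abs_nonneg _]
    simpa only [edist_dist, Real.dist_eq] using h2
  calc ∑ k ∈ Finset.range n, |v (k + 1) - v k|
      ≤ ∑ k ∈ Finset.range n, (|p (u (k + 1)) - p (u k)| + 2 * (δ / (2 * (n + 1)))) := by
        refine Finset.sum_le_sum fun k hk => ?_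
        have hk := Finset.mem_range.1 hk
        have a1 := abs_le.1 (hpu k (by omega))
        have a2 := abs_le.1 (hpu (k + 1) (by omega))
        have a3 := abs_le.1 (le_refl |p (u (k + 1)) - p (u k)|)
        rw [abs_le]
        constructor <;> linarith
    _ = ∑ k ∈ Finset.range n, |p (u (k + 1)) - p (u k)| + n * (2 * (δ / (2 * (n + 1)))) := by
        rw [Finset.sum_add_distrib]
        simp
    _ ≤ (tvNorm p).toReal + δ := by
        gcongr
        have : (n : ℝ) * (2 * (δ / (2 * (n + 1)))) = δ * (n / (n + 1)) := by field_simp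
        rw [this]
        exact mul_le_of_le_one_right hδ.le ((div_le_one (by positivity)).2 (by linarith))

/-- A non-negative function of finite integral takes small values on every set of infinite
measure. -/
theorem exists_mem_lt_of_lintegral_ne_top {p : ℝ → ℝ} (hfin : ∫⁻ x, ENNReal.ofReal (p x) ≠ ∞)
    {s : Set ℝ} (hsm : MeasurableSet s) (hs : volume s = ∞) {ε : ℝ} (hε : 0 < ε) :
    ∃ x ∈ s, p x < ε := by
  by_contra! h
  refine hfin (top_le_iff.1 ?_)
  calc ∞ = ENNReal.ofReal ε * volume s := by
        rw [hs, ENNReal.mul_top (by simpa using hε)]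
    _ = ∫⁻ _ in s, ENNReal.ofReal ε := (setLIntegral_const _ _).symm
    _ ≤ ∫⁻ x in s, ENNReal.ofReal (p x) :=
        setLIntegral_mono' hsm fun x hx => ENNReal.ofReal_le_ofReal (h x hx)
    _ ≤ _ := setLIntegral_le_lintegral _ _

/-- The infimum of `p` over the `m`-th cell `(t + m h, t + (m + 1) h]`, for `1 ≤ m ≤ N`, and zero
for other `m`. -/
noncomputable def cellInf (p : ℝ → ℝ) (t h : ℝ) (N m : ℕ) : ℝ :=
  if 1 ≤ m ∧ m ≤ N then sInf (p '' Set.Ioc (t + m * h) (t + (m + 1) * h)) else 0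

theorem bddBelow_image_of_nonneg {p : ℝ → ℝ} (hp : ∀ x, 0 ≤ p x) (s : Set ℝ) :
    BddBelow (p '' s) :=
  ⟨0, by rintro _ ⟨x, _, rfl⟩; exact hp x⟩

theorem nonempty_image_cell (p : ℝ → ℝ) (t : ℝ) {h : ℝ} (hh : 0 < h) (m : ℕ) :
    (p '' Set.Ioc (t + m * h) (t + (m + 1) * h)).Nonempty :=
  (Set.nonempty_Ioc.2 (by linarith)).image p

theorem cellInf_nonneg {p : ℝ → ℝ} (hp : ∀ x, 0 ≤ p x) (t h : ℝ) (N m : ℕ) :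
    0 ≤ cellInf p t h N m := by
  unfold cellInf
  split_ifs
  · exact Real.sInf_nonneg (by rintro _ ⟨x, _, rfl⟩; exact hp x)
  · exact le_rfl

theorem cellInf_le {p : ℝ → ℝ} (hp : ∀ x, 0 ≤ p x) {t h : ℝ} {m : ℕ} (N : ℕ) {x : ℝ}
    (hx : x ∈ Set.Ioc (t + m * h) (t + (m + 1) * h)) : cellInf p t h N m ≤ p x := by
  unfold cellInf
  split_ifs
  · exact csInf_le (bddBelow_image_of_nonneg hp _) ⟨x, hx, rfl⟩
  · exact hp x

/-- Close to optimal sample points for the cell infima, in increasing order. -/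
theorem exists_monotoneOn_sample {p : ℝ → ℝ} (hp : ∀ x, 0 ≤ p x)
    (hfin : ∫⁻ x, ENNReal.ofReal (p x) ≠ ∞) (t : ℝ) {h : ℝ} (hh : 0 < h) (N : ℕ) {ε : ℝ}
    (hε : 0 < ε) :
    ∃ u : ℕ → ℝ, MonotoneOn u (Set.Iic (N + 1)) ∧
      ∀ k ≤ N + 1, |p (u k) - cellInf p t h N k| ≤ ε := by
  have key : ∀ k : ℕ, ∃ x : ℝ, (1 ≤ k → t + k * h ≤ x) ∧ (k ≤ N → x ≤ t + (k + 1) * h) ∧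
      |p x - cellInf p t h N k| ≤ ε := by
    intro k
    by_cases hk : 1 ≤ k ∧ k ≤ N
    · obtain ⟨_, ⟨x, hx, rfl⟩, hlt⟩ := exists_lt_of_csInf_lt (nonempty_image_cell p t hh k)
        (lt_add_of_pos_right _ hε)
      refine ⟨x, fun _ => hx.1.le, fun _ => hx.2, ?_⟩
      have h1 := cellInf_le hp N hx
      rw [abs_of_nonneg (by linarith), cellInf, if_pos hk]
      linarith
    -- Outside the cells the prescribed value is zero; integrability provides points of a half-line,
    -- to the left or to the right of the cells, where `p` is small.
    · have hz : cellInf p t h N k = 0 := if_neg hk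
      rcases Nat.eq_zero_or_pos k with rfl | hk'
      · obtain ⟨x, hx, hlt⟩ := exists_mem_lt_of_lintegral_ne_top hfin
          (s := Set.Iic (t + ((0 : ℕ) + 1) * h)) measurableSet_Iic Real.volume_Iic hε
        refine ⟨x, fun h => by omega, fun _ => hx, ?_⟩
        rw [hz, sub_zero, abs_of_nonneg (hp x)]
        exact hlt.le
      · obtain ⟨x, hx, hlt⟩ := exists_mem_lt_of_lintegral_ne_top hfin
          (s := Set.Ici (t + k * h)) measurableSet_Ici Real.volume_Ici hε
        refine ⟨x, fun _ => hx, fun h => by omega, ?_⟩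
        rw [hz, sub_zero, abs_of_nonneg (hp x)]
        exact hlt.le
  choose u hu1 hu2 hu3 using key
  refine ⟨u, fun i _ j hj hij => ?_, fun k _ => hu3 k⟩
  rcases hij.eq_or_lt with rfl | hlt
  · exact le_rfl
  have hj : j ≤ N + 1 := hj
  have h1 := hu2 i (by omega)
  have h2 := hu1 j (by omega)
  have h3 : ((i : ℝ) + 1) * h ≤ j * h := by
    gcongr
    exact_mod_cast hlt
  linarith

theorem exists_mem_cell {t h x : ℝ} (hh : 0 < h) (hx : t < x) :
    ∃ m : ℕ, x ∈ Set.Ioc (t + m * h) (t + (m + 1) * h) := by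
  have hpos : 0 < (x - t) / h := div_pos (by linarith) hh
  have hc : 0 < ⌈(x - t) / h⌉₊ := Nat.ceil_pos.2 hpos
  obtain ⟨m, hm⟩ := Nat.exists_eq_succ_of_ne_zero hc.ne'
  refine ⟨m, ?_, ?_⟩
  · have : (m : ℝ) < (x - t) / h := Nat.lt_ceil.1 (by omega)
    rw [lt_div_iff₀ hh] at this
    linarith
  · have := Nat.le_ceil ((x - t) / h)
    rw [hm, div_le_iff₀ hh] at this
    push_cast at this
    linarith

/-- An interval mixture equal to the cell infima of `p`, with weight at most half the total
variation of `p`. -/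
theorem exists_intervalMixture_cellInf {p : ℝ → ℝ} (hp : ∀ x, 0 ≤ p x)
    (hfin : ∫⁻ x, ENNReal.ofReal (p x) ≠ ∞) (htv : tvNorm p < ∞) (t : ℝ) {h : ℝ} (hh : 0 < h)
    (N : ℕ) :
    ∃ M : IntervalMixture, 2 * M.weight ≤ (tvNorm p).toReal ∧ (∀ x ≤ t, M.fn x = 0) ∧
      ∀ m : ℕ, ∀ x ∈ Set.Ioc (t + m * h) (t + (m + 1) * h),
        M.fn x = ENNReal.ofReal (cellInf p t h N m) := by
  have h0 : cellInf p t h N 0 = 0 := if_neg (by omega)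
  have hN : ∀ m, N < m → cellInf p t h N m = 0 := fun m hm => if_neg (by omega)
  -- Going up to `N + 1` includes the final zero, so that the positive increments make up exactly
  -- half the variation.
  obtain ⟨ι, _, c, l, r, hc, hlr, hr, hsum, hw⟩ := exists_interval_decomposition
    (cellInf p t h N) (cellInf_nonneg hp t h N) h0 (N + 1)
  refine ⟨⟨ι, c, fun i => t + l i * h, fun i => (r i - l i) * h, hc, fun i => ?_⟩, ?_, ?_, ?_⟩
  · have : (l i : ℝ) ≤ r i := by exact_mod_cast (hlr i).le
    exact mul_nonneg (by linarith) hh.le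
  · rw [IntervalMixture.weight, hw, two_mul_sum_max_sub h0 (hN _ (by omega))]
    exact sum_abs_sub_le_tvNorm htv fun ε hε => exists_monotoneOn_sample hp hfin t hh N hε
  · intro x hx
    refine Finset.sum_eq_zero fun i _ => ?_
    have : x ∉ Set.Ioc (t + l i * h) (t + l i * h + (r i - l i) * h) := fun hx' => by
      have : 0 ≤ (l i : ℝ) * h := by positivity
      linarith [hx'.1]
    rw [box, Set.indicator_of_notMem this, mul_zero]
  · intro m x hx
    have hmem : ∀ i, x ∈ Set.Ioc (t + l i * h) (t + l i * h + (r i - l i) * h) ↔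
        l i ≤ m ∧ m < r i := by
      intro i
      have e : t + l i * h + (r i - l i) * h = t + r i * h := by ring
      rw [e]
      constructor
      · rintro ⟨h1, h2⟩
        have h3 : (l i : ℝ) * h < (m + 1) * h := by linarith [hx.2]
        have h4 : (m : ℝ) * h < r i * h := by linarith [hx.1]
        have h5 := lt_of_mul_lt_mul_right h3 hh.le
        have h6 := lt_of_mul_lt_mul_right h4 hh.le
        norm_cast at h5 h6
        omega
      · rintro ⟨h1, h2⟩
        have h3 : (l i : ℝ) * h ≤ m * h := by gcongr
        have h4 : ((m : ℝ) + 1) * h ≤ r i * h := by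
          gcongr
          exact_mod_cast h2
        exact ⟨by linarith [hx.1], by linarith [hx.2]⟩
    have hval : ∑ i, (if l i ≤ m ∧ m < r i then c i else 0) = cellInf p t h N m := by
      rcases le_or_gt m (N + 1) with hm | hm
      · exact hsum m hm
      · rw [hN m (by omega)]
        refine Finset.sum_eq_zero fun i _ => if_neg ?_
        have := hr i
        omega
    rw [← hval, ENNReal.ofReal_sum_of_nonneg fun i _ => by split_ifs; exacts [hc i, le_rfl]]
    refine Finset.sum_congr rfl fun i _ => ?_
    by_cases hi : l i ≤ m ∧ m < r i
    · rw [if_pos hi, box, Set.indicator_of_mem ((hmem i).2 hi), Pi.one_apply, mul_one]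
    · rw [if_neg hi, box, Set.indicator_of_notMem (mt (hmem i).1 hi), mul_zero, ENNReal.ofReal_zero]

/-- An integrable non-negative function of bounded variation is the almost everywhere limit of
interval mixtures below it whose weights are at most half its total variation. -/
theorem exists_intervalMixture_tendsto {p : ℝ → ℝ} (hp : ∀ x, 0 ≤ p x)
    (hfin : ∫⁻ x, ENNReal.ofReal (p x) ≠ ∞) (htv : tvNorm p < ∞) :
    ∃ M : ℕ → IntervalMixture, (∀ n, 2 * (M n).weight ≤ (tvNorm p).toReal) ∧
      (∀ n x, (M n).fn x ≤ ENNReal.ofReal (p x)) ∧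
      ∀ᵐ x, Tendsto (fun n => (M n).fn x) atTop (𝓝 (ENNReal.ofReal (p x))) := by
  have hh : ∀ n : ℕ, 0 < 1 / ((n : ℝ) + 1) := fun n => by positivity
  -- Mesh `1 / (n + 1)` starting at `-n`: the cells `1, …, 2 * n * (n + 1)` reach past `n`, so they
  -- exhaust the line while shrinking.
  choose M hw hz hc using fun n : ℕ => exists_intervalMixture_cellInf hp hfin htv (-(n : ℝ)) (hh n)
    (2 * n * (n + 1))
  refine ⟨M, hw, fun n x => ?_, ?_⟩
  · rcases le_or_gt x (-(n : ℝ)) with hx | hx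
    · rw [hz n x hx]
      exact zero_le
    · obtain ⟨m, hm⟩ := exists_mem_cell (hh n) hx
      rw [hc n m x hm]
      exact ENNReal.ofReal_le_ofReal (cellInf_le hp _ hm)
  -- Bounded variation gives differentiability, hence continuity, almost everywhere; at such points
  -- the infima over shrinking cells converge to `p x`.
  · have hbv : LocallyBoundedVariationOn p Set.univ :=
      BoundedVariationOn.locallyBoundedVariationOn htv.ne
    filter_upwards [hbv.ae_differentiableAt] with x hdiff
    have hcont : ContinuousAt p x := hdiff.continuousAt
    have hex : ∀ᶠ n : ℕ in atTop, ∃ m : ℕ, (1 ≤ m ∧ m ≤ 2 * n * (n + 1)) ∧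
        x ∈ Set.Ioc (-(n : ℝ) + m * (1 / ((n : ℝ) + 1)))
          (-(n : ℝ) + (m + 1) * (1 / ((n : ℝ) + 1))) := by
      filter_upwards [eventually_gt_atTop ⌈|x| + 1⌉₊] with n hn
      have hn' : |x| + 1 < n := Nat.lt_of_ceil_lt hn
      obtain ⟨hx1, hx2⟩ := abs_le.1 (le_refl |x|)
      obtain ⟨m, hm⟩ := exists_mem_cell (hh n) (show -(n : ℝ) < x by linarith)
      refine ⟨m, ⟨?_, ?_⟩, hm⟩
      · by_contra h0
        obtain rfl : m = 0 := by omega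
        have h1 := hm.2
        have h2 : 1 / ((n : ℝ) + 1) ≤ 1 := (div_le_one (by positivity)).2 (by linarith [abs_nonneg x])
        push_cast at h1
        linarith
      · have h1 : (m : ℝ) * (1 / ((n : ℝ) + 1)) ≤ 2 * n := by linarith [hm.1]
        rw [mul_one_div, div_le_iff₀ (by positivity)] at h1
        exact_mod_cast h1
    choose! m hm hmx using fun n (h : ∃ m : ℕ, (1 ≤ m ∧ m ≤ 2 * n * (n + 1)) ∧
        x ∈ Set.Ioc (-(n : ℝ) + m * (1 / ((n : ℝ) + 1)))
          (-(n : ℝ) + (m + 1) * (1 / ((n : ℝ) + 1)))) => h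
    have hlim : Tendsto
        (fun n : ℕ => cellInf p (-(n : ℝ)) (1 / ((n : ℝ) + 1)) (2 * n * (n + 1)) (m n)) atTop
        (𝓝 (p x)) := by
      rw [Metric.tendsto_nhds]
      intro ε hε
      obtain ⟨δ, hδ, hball⟩ := Metric.continuousAt_iff.1 hcont (ε / 2) (by positivity)
      filter_upwards [hex, (tendsto_one_div_add_atTop_nhds_zero_nat (𝕜 := ℝ)).eventually
        (gt_mem_nhds hδ)] with n hn hnδ
      have h1 := cellInf_le hp (2 * n * (n + 1)) (hmx n hn)
      have h2 : p x - ε / 2 ≤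
          cellInf p (-(n : ℝ)) (1 / ((n : ℝ) + 1)) (2 * n * (n + 1)) (m n) := by
        rw [cellInf, if_pos (hm n hn)]
        refine le_csInf (nonempty_image_cell p _ (hh n) _) ?_
        rintro _ ⟨y, hy, rfl⟩
        have hxn := hmx n hn
        have hdist : dist y x < δ := by
          rw [Real.dist_eq, abs_lt]
          constructor <;> linarith [hy.1, hy.2, hxn.1, hxn.2]
        have := (abs_lt.1 (Real.dist_eq _ _ ▸ hball hdist)).1
        linarith
      rw [Real.dist_eq, abs_lt]
      constructor <;> linarith
    refine ((ENNReal.continuous_ofReal.tendsto _).comp hlim).congr' ?_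
    filter_upwards [hex] with n hn
    exact (hc n (m n) x (hmx n hn)).symm

/-! ### Passage to the limit and the main theorem -/

theorem lconvolution_le_lintegral_mul {φ ψ : ℝ → ℝ≥0∞} {C : ℝ≥0∞} (hφ : Measurable φ)
    (hψ : ∀ x, ψ x ≤ C) (x : ℝ) : (φ ⋆ₗ ψ) x ≤ (∫⁻ y, φ y) * C := by
  rw [lconvolution_def, ← lintegral_mul_const _ hφ]
  exact lintegral_mono fun y => by gcongr; exact hψ _

/-- Dominated convergence at every `x` where the limiting convolution is finite. The reflection `y ↦
x - y` preserves Lebesgue measure, hence also almost everywhere convergence; finite values exclude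
the product `0 * ∞`. -/
theorem tendsto_lconvolution_of_le {φ ψ : ℝ → ℝ≥0∞} {φn ψn : ℕ → ℝ → ℝ≥0∞}
    (hφm : ∀ n, Measurable (φn n)) (hψm : ∀ n, Measurable (ψn n))
    (hφle : ∀ n x, φn n x ≤ φ x) (hψle : ∀ n x, ψn n x ≤ ψ x)
    (hφ : ∀ᵐ x, Tendsto (fun n => φn n x) atTop (𝓝 (φ x)))
    (hψ : ∀ᵐ x, Tendsto (fun n => ψn n x) atTop (𝓝 (ψ x)))
    (hφfin : ∀ x, φ x ≠ ∞) (hψfin : ∀ x, ψ x ≠ ∞) {x : ℝ} (hfin : (φ ⋆ₗ ψ) x ≠ ∞) :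
    Tendsto (fun n => (φn n ⋆ₗ ψn n) x) atTop (𝓝 ((φ ⋆ₗ ψ) x)) := by
  simp only [lconvolution_def] at hfin ⊢
  refine tendsto_lintegral_of_dominated_convergence (fun y => φ y * ψ (-y + x)) (fun n => ?_)
    (fun n => Eventually.of_forall fun y => mul_le_mul' (hφle n _) (hψle n _)) hfin ?_
  · have := hφm n
    have := hψm n
    fun_prop
  · have h := (Measure.measurePreserving_sub_left volume x).quasiMeasurePreserving.ae hψ
    filter_upwards [hφ, h] with y h1 h2
    rw [sub_eq_neg_add] at h2
    exact ENNReal.Tendsto.mul h1 (Or.inr (hψfin _)) h2 (Or.inr (hφfin _))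

/-- A bounded factor makes the convolutions finite everywhere, so the approximations converge at
every point. -/
theorem exists_ofReal_le_of_tvNorm_lt_top {p : ℝ → ℝ} (htv : tvNorm p < ∞) :
    ∃ C : ℝ, ∀ x, ENNReal.ofReal (p x) ≤ ENNReal.ofReal C := by
  refine ⟨p 0 + (tvNorm p).toReal, fun x => ENNReal.ofReal_le_ofReal ?_⟩
  have := BoundedVariationOn.dist_le (f := p) (s := Set.univ) htv.ne (Set.mem_univ x)
    (Set.mem_univ 0)
  rw [Real.dist_eq] at this
  have h2 : |p x - p 0| ≤ (tvNorm p).toReal := this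
  linarith [le_abs_self (p x - p 0)]

/-- The convolution of three probability densities of bounded variation is absolutely continuous,
with Fisher integral bounded through the total variations. -/
theorem fisherIntegral_lconvolution_le {p q r : ℝ → ℝ}
    (hp : ∀ x, 0 ≤ p x) (hq : ∀ x, 0 ≤ q x) (hr : ∀ x, 0 ≤ r x)
    (hpm : Measurable p) (hqm : Measurable q)
    (hp1 : ∫⁻ x, ENNReal.ofReal (p x) = 1) (hq1 : ∫⁻ x, ENNReal.ofReal (q x) = 1)
    (hr1 : ∫⁻ x, ENNReal.ofReal (r x) = 1)
    (hpv : tvNorm p < ∞) (hqv : tvNorm q < ∞) (hrv : tvNorm r < ∞) {f : ℝ → ℝ≥0∞}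
    (hf : f = (fun x => ENNReal.ofReal (p x)) ⋆ₗ
      ((fun x => ENNReal.ofReal (q x)) ⋆ₗ fun x => ENNReal.ofReal (r x))) :
    (∀ x, f x ≠ ∞) ∧ IsAbsCont (fun x => (f x).toReal) ∧
      fisherIntegral (fun x => (f x).toReal) ≤
        (1 / 2) * (tvNorm p * tvNorm q + tvNorm p * tvNorm r + tvNorm q * tvNorm r) := by
  obtain ⟨C, hC⟩ := exists_ofReal_le_of_tvNorm_lt_top hrv
  have hqr : ∀ x, ((fun x => ENNReal.ofReal (q x)) ⋆ₗ fun x => ENNReal.ofReal (r x)) x ≤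
      ENNReal.ofReal C := fun x => by
    simpa [hq1] using lconvolution_le_lintegral_mul hqm.ennreal_ofReal hC x
  have hqrfin := fun x => ((hqr x).trans_lt ENNReal.ofReal_lt_top).ne
  have hffin : ∀ x, f x ≠ ∞ := fun x => by
    have := lconvolution_le_lintegral_mul hpm.ennreal_ofReal hqr x
    rw [hp1, one_mul, ← hf] at this
    exact (this.trans_lt ENNReal.ofReal_lt_top).ne
  refine ⟨hffin, ?_⟩
  obtain ⟨P, hPw, hPle, hPt⟩ := exists_intervalMixture_tendsto hp (by simp [hp1]) hpv
  obtain ⟨Q, hQw, hQle, hQt⟩ := exists_intervalMixture_tendsto hq (by simp [hq1]) hqv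
  obtain ⟨R, hRw, hRle, hRt⟩ := exists_intervalMixture_tendsto hr (by simp [hr1]) hrv
  have hmass : ∀ (M : IntervalMixture) (p : ℝ → ℝ), (∀ x, M.fn x ≤ ENNReal.ofReal (p x)) →
      ∫⁻ x, ENNReal.ofReal (p x) = 1 → M.mass ≤ 1 := fun M p h h1 => by
    rw [← ENNReal.ofReal_le_one, ← M.lintegral_fn, ← h1]
    exact lintegral_mono h
  have hQR := fun x => tendsto_lconvolution_of_le (fun n => (Q n).measurable_fn)
    (fun n => (R n).measurable_fn) hQle hRle hQt hRt (fun _ => ENNReal.ofReal_ne_top)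
    (fun _ => ENNReal.ofReal_ne_top) (hqrfin x)
  have hlim : ∀ x, Tendsto (fun n => IntervalMixture.conv₃ (P n) (Q n) (R n) x) atTop
      (𝓝 (f x).toReal) := by
    intro x
    have h1 := tendsto_lconvolution_of_le (x := x)
      (ψ := (fun x => ENNReal.ofReal (q x)) ⋆ₗ fun x => ENNReal.ofReal (r x))
      (fun n => (P n).measurable_fn)
      (fun n => measurable_lconvolution volume (Q n).measurable_fn (R n).measurable_fn) hPle
      (fun n y => lintegral_mono fun z => mul_le_mul' (hQle n _) (hRle n _)) hPt
      (Eventually.of_forall hQR) (fun _ => ENNReal.ofReal_ne_top) hqrfin (hf ▸ hffin x)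
    rw [← hf] at h1
    refine ((ENNReal.tendsto_toReal (hffin x)).comp h1).congr fun n => ?_
    have hnn : 0 ≤ IntervalMixture.conv₃ (P n) (Q n) (R n) x := by
      obtain ⟨_, _, h⟩ := IntervalMixture.hasFisherControl_conv₃ (P n) (Q n) (R n)
      exact h.nonneg x
    rw [Function.comp_apply, IntervalMixture.lconvolution_eq, ENNReal.toReal_ofReal hnn]
  set a := (tvNorm p).toReal with ha
  set b := (tvNorm q).toReal with hb
  set c := (tvNorm r).toReal with hc
  have ha0 : 0 ≤ a := ENNReal.toReal_nonneg
  have hb0 : 0 ≤ b := ENNReal.toReal_nonneg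
  have hc0 : 0 ≤ c := ENNReal.toReal_nonneg
  -- Weights are at most half the variations and masses at most 1, so both constants are uniform in
  -- `n`.
  have hcontrol : ∀ n, HasFisherControl (a / 2 * (b / 2 * (c / 2)))
      (1 / 2 * (a * b + a * c + b * c)) (IntervalMixture.conv₃ (P n) (Q n) (R n)) := by
    intro n
    have w1 : (P n).weight ≤ a / 2 := by linarith [hPw n]
    have w2 : (Q n).weight ≤ b / 2 := by linarith [hQw n]
    have w3 : (R n).weight ≤ c / 2 := by linarith [hRw n]
    have v1 := (P n).weight_nonneg
    have v2 := (Q n).weight_nonneg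
    have v3 := (R n).weight_nonneg
    have u2 := (Q n).mass_nonneg
    have u3 := (R n).mass_nonneg
    have m1 := hmass _ _ (hPle n) hp1
    have m2 := hmass _ _ (hQle n) hq1
    have m3 := hmass _ _ (hRle n) hr1
    refine (IntervalMixture.hasFisherControl_conv₃ (P n) (Q n) (R n)).mono (by gcongr) ?_
    calc _ ≤ 2 * (1 * (b / 2) * (c / 2) + (a / 2) * 1 * (c / 2) + (a / 2) * (b / 2) * 1) := by
          have k1 : (P n).mass * (Q n).weight * (R n).weight ≤ 1 * (b / 2) * (c / 2) := by
            gcongr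
          have k2 : (P n).weight * (Q n).mass * (R n).weight ≤ (a / 2) * 1 * (c / 2) := by
            gcongr
          have k3 : (P n).weight * (Q n).weight * (R n).mass ≤ (a / 2) * (b / 2) * 1 := by
            gcongr
          linarith
      _ = _ := by ring
  obtain ⟨h1, h2⟩ := isAbsCont_and_fisherIntegral_le_of_tendsto hcontrol hlim
  refine ⟨h1, h2.trans (le_of_eq ?_)⟩
  rw [← ENNReal.ofReal_toReal hpv.ne, ← ENNReal.ofReal_toReal hqv.ne,
    ← ENNReal.ofReal_toReal hrv.ne, ← ha, ← hb, ← hc, ← ENNReal.ofReal_mul ha0,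
    ← ENNReal.ofReal_mul ha0, ← ENNReal.ofReal_mul hb0, ← ENNReal.ofReal_add (by positivity)
    (by positivity), ← ENNReal.ofReal_add (by positivity) (by positivity),
    ENNReal.ofReal_mul (by norm_num)]
  congr 1
  rw [ENNReal.ofReal_div_of_pos (by norm_num)]
  simp

theorem proposition4p1 {Ω : Type*} [MeasurableSpace Ω] (μ : Measure Ω) [IsProbabilityMeasure μ]
    (X : Fin 3 → Ω → ℝ) (hX : ∀ i, Measurable (X i)) (hind : iIndepFun X μ)
    (p : Fin 3 → ℝ → ℝ) (hp : ∀ i, IsDensity (μ.map (X i)) (p i))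
    (htv : ∀ i, tvNorm (p i) < ∞) :
    fisherInfo (μ.map fun ω => X 0 ω + X 1 ω + X 2 ω) < ∞ ∧
    fisherInfo (μ.map fun ω => X 0 ω + X 1 ω + X 2 ω) ≤
      (1 / 2) * (tvNorm (p 0) * tvNorm (p 1) + tvNorm (p 0) * tvNorm (p 2)
        + tvNorm (p 1) * tvNorm (p 2)) := by
  have htotal : ∀ i, ∫⁻ x, ENNReal.ofReal (p i x) = 1 := by
    intro i
    have := Measure.isProbabilityMeasure_map (μ := μ) (hX i).aemeasurable
    have h1 := measure_univ (μ := μ.map (X i))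
    rwa [(hp i).eq_withDensity, withDensity_apply _ MeasurableSet.univ,
      Measure.restrict_univ] at h1
  obtain ⟨hfin, hac, hle⟩ := fisherIntegral_lconvolution_le (hp 0).nonneg (hp 1).nonneg
    (hp 2).nonneg (hp 0).measurable (hp 1).measurable (htotal 0) (htotal 1) (htotal 2)
    (htv 0) (htv 1) (htv 2) rfl
  have hm := fun i => (hp i).measurable.ennreal_ofReal
  have hmf := measurable_lconvolution volume (hm 0) (measurable_lconvolution volume (hm 1) (hm 2))
  -- The real-valued triple convolution is the version of the density of the sum shown above to be
  -- absolutely continuous.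
  have hdens : IsDensity (μ.map fun ω => X 0 ω + X 1 ω + X 2 ω) fun x =>
      (((fun x => ENNReal.ofReal (p 0 x)) ⋆ₗ ((fun x => ENNReal.ofReal (p 1 x)) ⋆ₗ
        fun x => ENNReal.ofReal (p 2 x))) x).toReal := by
    refine ⟨hmf.ennreal_toReal, fun x => ENNReal.toReal_nonneg, ?_⟩
    simp only [ENNReal.ofReal_toReal (hfin _)]
    have e : (fun ω => X 0 ω + X 1 ω + X 2 ω) = X 0 + (X 1 + X 2) := by
      ext ω
      simp [add_assoc]
    have i12 : IndepFun (X 1) (X 2) μ := hind.indepFun (by decide)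
    have i0 : IndepFun (X 0) (X 1 + X 2) μ :=
      hind.indepFun_add_right hX 0 1 2 (by decide) (by decide)
    rw [e, i0.map_add_eq_map_conv_map (hX 0) ((hX 1).add (hX 2)),
      i12.map_add_eq_map_conv_map (hX 1) (hX 2), (hp 0).eq_withDensity, (hp 1).eq_withDensity,
      (hp 2).eq_withDensity, conv_withDensity_eq_lconvolution (hm 1) (hm 2),
      conv_withDensity_eq_lconvolution (hm 0) (measurable_lconvolution volume (hm 1) (hm 2))]
  have hinfo : fisherInfo (μ.map fun ω => X 0 ω + X 1 ω + X 2 ω) ≤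
      (1 / 2) * (tvNorm (p 0) * tvNorm (p 1) + tvNorm (p 0) * tvNorm (p 2)
        + tvNorm (p 1) * tvNorm (p 2)) :=
    (fisherInfo_eq hdens hac).trans_le hle
  refine ⟨hinfo.trans_lt (ENNReal.mul_lt_top (by simp) ?_), hinfo⟩
  simp only [ENNReal.add_lt_top]
  exact ⟨⟨ENNReal.mul_lt_top (htv 0) (htv 1), ENNReal.mul_lt_top (htv 0) (htv 2)⟩,
    ENNReal.mul_lt_top (htv 1) (htv 2)⟩
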